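/- For an integer $m\ge 1$ and real $j,k$, let $$I_{j,k}(m)=\int_{1}^{\infty}\frac{dx_m}{x_m}\prod_{l=1}^{m-1}\left[\int_0^\infty\frac{dx_l}{x_l}\,\frac{(x_l/x_{l+1})^{j-1/2}}{(1+x_l/x_{l+1})^{j+k-1/2}}\right]\frac{x_1^{k}}{(1+x_1)^{j+k-1/2}},$$ that is, the $m$-fold integral of the displayed integrand over $x_1,\dots,x_{m-1}>0$, $x_m>1$. Fix $m\ge 1$ and $l_1,l_2\in\mathbb{R}$. Then, as $j\to\infty$ through the positive integers, $$I_{j+l_1,j+l_2}(m)=j^{-m/2}\,4^{-mj}\,2^{-m(l_1+l_2-2)}\left(a_0(m)+a_{1,l_1,l_2}(m)\,j^{-1/2}+O(1/j)\right),$$ where $$a_0(m)=\pi^{m/2}\,2^{-m/2-1},\qquad a_{1,l_1,l_2}(m)=\pi^{(m-1)/2}\,2^{-m/2-1}\left(\tfrac12-l_1+l_2\right)m^{1/2},$$ and the implied constant may depend on $m,l_1,l_2$. -/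

import Mathlib

open Filter Asymptotics MeasureTheory

/-- The integrand of the `(n + 1)`-fold integral. The variables `x 0, …, x n` are
`x_1, …, x_m` with `m = n + 1`; the first product collects the factors `1 / x_l`, `1 ≤ l ≤ m`. -/
noncomputable def foldIntegrand (n : ℕ) (j k : ℝ) (x : Fin (n + 1) → ℝ) : ℝ :=
  (∏ l, 1 / x l) *
    (∏ l : Fin n, (x l.castSucc / x l.succ) ^ (j - 1 / 2) /
      (1 + x l.castSucc / x l.succ) ^ (j + k - 1 / 2)) *
    (x 0 ^ k / (1 + x 0) ^ (j + k - 1 / 2))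

/-- The domain of integration: `x_1, …, x_{m-1} > 0` and `x_m > 1`, where `m = n + 1`. -/
def foldDomain (n : ℕ) : Set (Fin (n + 1) → ℝ) :=
  {x | (∀ l, 0 < x l) ∧ 1 < x (Fin.last n)}

/-- The `m`-fold integral `I_{j,k}(m)`, for `m ≥ 1` (the value at `m = 0` is irrelevant). -/
noncomputable def foldIntegral : (m : ℕ) → (j k : ℝ) → ℝ
  | 0, _, _ => 0
  | n + 1, j, k => ∫ x in foldDomain n, foldIntegrand n j k x

/-- The leading coefficient `a_0(m)`. -/
noncomputable def coeffZero (m : ℕ) : ℝ :=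
  Real.pi ^ ((m : ℝ) / 2) * (2 : ℝ) ^ (-(m : ℝ) / 2 - 1)

/-- The second coefficient `a_{1,l₁,l₂}(m)`. -/
noncomputable def coeffOne (l₁ l₂ : ℝ) (m : ℕ) : ℝ :=
  Real.pi ^ (((m : ℝ) - 1) / 2) * (2 : ℝ) ^ (-(m : ℝ) / 2 - 1) * (1 / 2 - l₁ + l₂) *
    (m : ℝ) ^ (1 / 2 : ℝ)

/-! Write `x_l = exp (y_l)` and pass to the increments of `y`. The kernel factors depend on ratios
only, so the integrand splits into identical factors, one per increment `t_i`, while `x_m > 1`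
becomes `∑ t_i > 0` (`foldIntegral_eq_setIntegral_prod`). Each factor is a power of `2`, times a
tilt `exp (((k - j) / 2 + 1 / 4) t)`, times the even function `cosh (t / 2) ^ (-(j + k - 1 / 2))`
(`logFactor_eq_cosh`).

Now put `t = s / r` with `r = √j`. The half space is invariant under scaling, the `cosh` power tends
to `exp (-s ^ 2 / 4)` with error of order `1 / r ^ 2`, and the tilt is `exp (c S / r)`, where `S = ∑
s_i` and `c = (l₂ - l₁) / 2 + 1 / 4`. Hence the `1 / r` term comes from the tilt alone.
`exists_abs_tilted_prod_sub_le` makes this uniform against an integrable majorant. What remains is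
the mass and the first moment of a centered Gaussian `S` on `S > 0`
(`setIntegral_one_add_mul_sum_mul_prod`). -/

/-! ### Elementary bounds for `cosh` and its logarithm. -/

lemma one_add_sq_div_two_le_cosh (x : ℝ) : 1 + x ^ 2 / 2 ≤ Real.cosh x := by
  have h1 : |x| / 2 ≤ Real.sinh (|x| / 2) := Real.self_le_sinh_iff.2 (by positivity)
  have h2 : Real.cosh |x| = Real.cosh (|x| / 2) ^ 2 + Real.sinh (|x| / 2) ^ 2 := by
    rw [← Real.cosh_two_mul]; ring_nf
  rw [← Real.cosh_abs, h2, Real.cosh_sq, ← sq_abs x]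
  nlinarith [abs_nonneg x]

/-- A family of lower bounds for `cosh` by exponentials of affine functions. -/
lemma exp_mul_abs_sub_sq_le_cosh {y : ℝ} (_ : 0 ≤ y) (hy1 : y ≤ 1) (x : ℝ) :
    Real.exp (y * |x| / 3 - y ^ 2 / 6) ≤ Real.cosh x := by
  have hc : 1 + x ^ 2 / 2 ≤ Real.cosh x := one_add_sq_div_two_le_cosh x
  rcases le_or_gt |x| 2 with hx | hx
  · have h1 : y * |x| / 3 - y ^ 2 / 6 ≤ x ^ 2 / 6 := by
      nlinarith [sq_nonneg (|x| - y), sq_abs x]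
    have hx2 : x ^ 2 ≤ 4 := by nlinarith [sq_abs x, abs_nonneg x]
    have h2 : Real.exp (x ^ 2 / 6) ≤ 1 + x ^ 2 / 2 := by
      -- `exp u ≤ 1 / (1 - u)` suffices: `(1 + x² / 2) (1 - x² / 6) = 1 + x² / 3 - x⁴ / 12` is at
      -- least `1` exactly when `x² ≤ 4`, whence the split at `|x| = 2`.
      have h3 := Real.exp_bound_div_one_sub_of_interval (x := x ^ 2 / 6) (by positivity)
        (by linarith)
      refine h3.trans ?_
      rw [div_le_iff₀ (by linarith)]
      nlinarith [sq_nonneg x]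
    exact (Real.exp_le_exp.2 h1).trans (h2.trans hc)
  · have h1 : y * |x| / 3 - y ^ 2 / 6 ≤ |x| - Real.log 2 := by
      have := Real.log_two_lt_d9
      nlinarith [sq_nonneg y]
    refine (Real.exp_le_exp.2 h1).trans ?_
    rw [Real.exp_sub, Real.exp_log two_pos, ← Real.cosh_abs x, Real.cosh_eq]
    have := Real.exp_pos (-|x|)
    linarith

/-- Second order expansion of `log cosh`. -/
lemma abs_log_cosh_sub_le (x : ℝ) : |Real.log (Real.cosh x) - x ^ 2 / 2| ≤ x ^ 4 / 8 := by
  have hpos := Real.cosh_pos x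
  have hup : Real.log (Real.cosh x) ≤ x ^ 2 / 2 :=
    (Real.log_le_iff_le_exp hpos).2 (Real.cosh_le_exp_half_sq x)
  have hlow : x ^ 2 / 2 - x ^ 4 / 8 ≤ Real.log (Real.cosh x) := by
    have h1 : Real.log (1 + x ^ 2 / 2) ≤ Real.log (Real.cosh x) :=
      Real.log_le_log (by positivity) (one_add_sq_div_two_le_cosh x)
    have h2 := Real.le_log_one_add_of_nonneg (x := x ^ 2 / 2) (by positivity)
    have h3 : x ^ 2 / 2 - x ^ 4 / 8 ≤ 2 * (x ^ 2 / 2) / (x ^ 2 / 2 + 2) := by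
      rw [le_div_iff₀ (by positivity)]
      nlinarith [sq_nonneg (x ^ 3)]
    linarith
  rw [abs_le]
  constructor <;> nlinarith [sq_nonneg (x ^ 2)]

lemma abs_log_cosh_le (x : ℝ) : |Real.log (Real.cosh x)| ≤ x ^ 2 / 2 := by
  rw [abs_of_nonneg (Real.log_nonneg (Real.one_le_cosh x))]
  exact (Real.log_le_iff_le_exp (Real.cosh_pos x)).2 (Real.cosh_le_exp_half_sq x)

lemma abs_exp_sub_exp_le {u v B : ℝ} (hu : Real.exp u ≤ B) (hv : Real.exp v ≤ B) :
    |Real.exp u - Real.exp v| ≤ |u - v| * B := by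
  have key : ∀ a b : ℝ, Real.exp a ≤ B → b ≤ a → |Real.exp a - Real.exp b| ≤ |a - b| * B := by
    intro a b ha hab
    rw [abs_of_nonneg (sub_nonneg.2 (Real.exp_le_exp.2 hab)), abs_of_nonneg (sub_nonneg.2 hab)]
    have h1 : Real.exp b = Real.exp a * Real.exp (b - a) := by rw [← Real.exp_add]; ring_nf
    have h2 := Real.add_one_le_exp (b - a)
    have h3 := Real.exp_pos a
    rw [h1]
    nlinarith
  rcases le_total v u with h | h
  · exact key u v hu h
  · rw [abs_sub_comm, abs_sub_comm u]
    exact key v u hv h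

/-! ### Gaussian limit of rescaled `cosh` powers. -/

/-- The rescaled power of `cosh` that converges to the Gaussian `exp (-s ^ 2 / 4)`. -/
noncomputable def coshProfile (b r s : ℝ) : ℝ := Real.cosh (s / (2 * r)) ^ (-(2 * r ^ 2 + b))

lemma coshProfile_nonneg (b r s : ℝ) : 0 ≤ coshProfile b r s :=
  Real.rpow_nonneg (Real.cosh_pos _).le _

lemma continuous_coshProfile (b r : ℝ) : Continuous (coshProfile b r) := by
  unfold coshProfile
  refine Continuous.rpow_const ?_ fun s => Or.inl (Real.cosh_pos _).ne'
  exact Real.continuous_cosh.comp (continuous_id.div_const _)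

lemma coshProfile_eq_exp (b r s : ℝ) :
    coshProfile b r s = Real.exp (-(2 * r ^ 2 + b) * Real.log (Real.cosh (s / (2 * r)))) := by
  rw [coshProfile, Real.rpow_def_of_pos (Real.cosh_pos _), mul_comm]

/-- Since `|b| ≤ r²`, the exponent `2r² + b` is at least `r²`. The affine bound for `log cosh` at
slope parameter `y = 1 / r` then yields an exponential majorant independent of `r`. -/
lemma coshProfile_le {b r : ℝ} (hr : 1 ≤ r) (hb : |b| ≤ r ^ 2) (s : ℝ) :
    coshProfile b r s ≤ Real.exp (1 / 6 - |s| / 6) := by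
  rw [coshProfile_eq_exp, Real.exp_le_exp]
  have hr0 : 0 < r := by linarith
  have h1 := exp_mul_abs_sub_sq_le_cosh (y := 1 / r) (by positivity)
    (by rw [div_le_one hr0]; exact hr) (s / (2 * r))
  rw [← Real.le_log_iff_exp_le (Real.cosh_pos _), abs_div, abs_of_pos (by positivity : 0 < 2 * r)]
    at h1
  have h2 : r ^ 2 * (1 / r * (|s| / (2 * r)) / 3 - (1 / r) ^ 2 / 6) = |s| / 6 - 1 / 6 := by
    field_simp
    ring
  have h3 : 0 ≤ Real.log (Real.cosh (s / (2 * r))) := Real.log_nonneg (Real.one_le_cosh _)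
  have h4 := mul_le_mul_of_nonneg_left h1 (sq_nonneg r)
  have h5 := (abs_le.1 hb).1
  nlinarith

lemma exp_neg_sq_div_four_le (s : ℝ) :
    Real.exp (-s ^ 2 / 4) ≤ Real.exp (1 / 6 - |s| / 6) := by
  rw [Real.exp_le_exp]
  nlinarith [sq_nonneg (|s| - 1 / 3), sq_abs s]

lemma abs_coshProfile_sub_le {b r : ℝ} (hr : 1 ≤ r) (hb : |b| ≤ r ^ 2) (s : ℝ) :
    |coshProfile b r s - Real.exp (-s ^ 2 / 4)| ≤
      (s ^ 4 / 64 + |b| * s ^ 2 / 8) / r ^ 2 * Real.exp (1 / 6 - |s| / 6) := by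
  have h0 := coshProfile_le hr hb s
  rw [coshProfile_eq_exp] at h0 ⊢
  refine (abs_exp_sub_exp_le h0 (exp_neg_sq_div_four_le s)).trans ?_
  refine mul_le_mul_of_nonneg_right ?_ (Real.exp_pos _).le
  have hr0 : 0 < r := by linarith
  set x := s / (2 * r) with hx
  have hs : s = 2 * r * x := by rw [hx]; field_simp
  -- The quadratic part of `2r² log cosh x` cancels `s² / 4` exactly; only its quartic remainder and
  -- the `b` term survive, both of order `1 / r²`.
  have e1 : -(2 * r ^ 2 + b) * Real.log (Real.cosh x) - -s ^ 2 / 4 =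
      -(2 * r ^ 2 * (Real.log (Real.cosh x) - x ^ 2 / 2) + b * Real.log (Real.cosh x)) := by
    rw [hs]; ring
  have e2 : (s ^ 4 / 64 + |b| * s ^ 2 / 8) / r ^ 2 =
      2 * r ^ 2 * (x ^ 4 / 8) + |b| * (x ^ 2 / 2) := by
    rw [hs]; field_simp; ring
  rw [e1, e2, abs_neg]
  refine (abs_add_le _ _).trans ?_
  rw [abs_mul, abs_mul b, abs_of_pos (by positivity : 0 < 2 * r ^ 2)]
  gcongr
  · exact abs_log_cosh_sub_le x
  · exact abs_log_cosh_le x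

/-! ### Uniform first order expansion of the tilted product. -/

/-- A power is dominated by an exponential. -/
lemma abs_pow_le_mul_exp (n : ℕ) {δ : ℝ} (hδ : 0 < δ) (s : ℝ) :
    |s| ^ n ≤ n.factorial / δ ^ n * Real.exp (δ * |s|) := by
  have h := Real.pow_div_factorial_le_exp (δ * |s|) (by positivity) n
  rw [div_le_iff₀ (by positivity), mul_pow] at h
  rw [div_mul_eq_mul_div, le_div_iff₀ (by positivity)]
  linarith

lemma abs_exp_sub_one_sub_le (x : ℝ) : |Real.exp x - 1 - x| ≤ x ^ 2 * Real.exp |x| := by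
  have h := Complex.norm_exp_sub_sum_le_norm_mul_exp (x : ℂ) 2
  simp only [Finset.sum_range_succ, Finset.sum_range_zero] at h
  norm_num at h
  rw [← Complex.ofReal_exp] at h
  have : Real.exp x - 1 - x = Real.exp x - (1 + x) := by ring
  rw [this, ← Real.norm_eq_abs, ← Complex.norm_real]
  exact_mod_cast h

/-- Telescoping: the factors are exchanged one at a time, and each exchange costs `ε` times the full
product of majorants. -/
lemma abs_prod_sub_prod_le {ι : Type*} (t : Finset ι) {f g ψ : ι → ℝ} {ε : ℝ}
    (hf : ∀ i, |f i| ≤ ψ i) (hg : ∀ i, |g i| ≤ ψ i) (hfg : ∀ i, |f i - g i| ≤ ε * ψ i) :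
    |∏ i ∈ t, f i - ∏ i ∈ t, g i| ≤ t.card * ε * ∏ i ∈ t, ψ i := by
  classical
  induction t using Finset.induction_on with
  | empty => simp
  | insert a t ha ih =>
    rw [Finset.prod_insert ha, Finset.prod_insert ha, Finset.prod_insert ha,
      Finset.card_insert_of_notMem ha]
    have hψ : ∀ i, 0 ≤ ψ i := fun i => (abs_nonneg _).trans (hf i)
    have h1 : f a * ∏ i ∈ t, f i - g a * ∏ i ∈ t, g i =
        f a * (∏ i ∈ t, f i - ∏ i ∈ t, g i) + (f a - g a) * ∏ i ∈ t, g i := by ring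
    have h2 : |∏ i ∈ t, g i| ≤ ∏ i ∈ t, ψ i := by
      rw [Finset.abs_prod]
      exact Finset.prod_le_prod (fun _ _ => abs_nonneg _) fun i _ => hg i
    rw [h1]
    refine (abs_add_le _ _).trans ?_
    rw [abs_mul, abs_mul]
    have h3 := mul_le_mul (hf a) ih (abs_nonneg _) (hψ a)
    have h4 := mul_le_mul (hfg a) h2 (abs_nonneg _) ((abs_nonneg _).trans (hfg a))
    push_cast
    linarith

lemma exp_mul_abs_sum_le {ι : Type*} [Fintype ι] {δ : ℝ} (hδ : 0 ≤ δ) (s : ι → ℝ) :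
    Real.exp (δ * |∑ i, s i|) ≤ ∏ i, Real.exp (δ * |s i|) := by
  rw [← Real.exp_sum, Real.exp_le_exp, ← Finset.mul_sum]
  exact mul_le_mul_of_nonneg_left (Finset.abs_sum_le_sum_abs _ _) hδ

/-- Uniform comparison of the tilted product of rescaled `cosh` powers with its first order
expansion around the Gaussian. -/
lemma exists_abs_tilted_prod_sub_le (ι : Type*) [Fintype ι] (b c : ℝ) :
    ∃ C R : ℝ, 1 ≤ R ∧ ∀ r, R ≤ r → ∀ s : ι → ℝ,
      |Real.exp (c / r * ∑ i, s i) * ∏ i, coshProfile b r (s i) -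
        (1 + c / r * ∑ i, s i) * ∏ i, Real.exp (-(s i) ^ 2 / 4)| ≤
      C / r ^ 2 * ∏ i, Real.exp (-(1 / 24) * |s i|) := by
  set K : ℝ := Real.exp (1 / 6) with hK
  set D : ℝ := (4 : ℕ).factorial / (1 / 12) ^ 4 / 64 +
    |b| * ((2 : ℕ).factorial / (1 / 12) ^ 2) / 8 with hD
  set n : ℝ := (Fintype.card ι : ℝ) with hn
  set T : ℝ := (2 : ℕ).factorial / (1 / 48) ^ 2 with hT
  -- The two summands pay for replacing the profiles by Gaussians and for linearizing the tilt. The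
  -- threshold gives `|b| ≤ r²` and `|c / r| ≤ 1 / 48`.
  refine ⟨n * D * K ^ Fintype.card ι + c ^ 2 * T * K ^ Fintype.card ι,
    1 + |b| + 48 * |c|, by linarith [abs_nonneg b, abs_nonneg c], fun r hr s => ?_⟩
  have hbn := abs_nonneg b
  have hcn := abs_nonneg c
  have hr1 : 1 ≤ r := by linarith
  have hr0 : 0 < r := by linarith
  have hbr : |b| ≤ r ^ 2 := by nlinarith
  have hcr : |c / r| ≤ 1 / 48 := by
    rw [abs_div, abs_of_pos hr0, div_le_iff₀ hr0]; linarith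
  set S := ∑ i, s i with hS
  have hψ : ∀ x : ℝ, Real.exp (1 / 6 - |x| / 6) ≤ K * Real.exp (-(1 / 12) * |x|) := by
    intro x
    rw [hK, ← Real.exp_add, Real.exp_le_exp]
    linarith [abs_nonneg x]
  have hdiff : ∀ x : ℝ, |coshProfile b r x - Real.exp (-x ^ 2 / 4)| ≤
      D / r ^ 2 * (K * Real.exp (-(1 / 12) * |x|)) := by
    intro x
    refine (abs_coshProfile_sub_le hr1 hbr x).trans ?_
    have h4 := abs_pow_le_mul_exp 4 (by norm_num : (0 : ℝ) < 1 / 12) x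
    have h2 := abs_pow_le_mul_exp 2 (by norm_num : (0 : ℝ) < 1 / 12) x
    have e4 : |x| ^ 4 = x ^ 4 := by rw [← abs_pow]; exact abs_of_nonneg (by positivity)
    rw [e4] at h4
    rw [sq_abs] at h2
    have e : x ^ 4 / 64 + |b| * x ^ 2 / 8 ≤ D * Real.exp (1 / 12 * |x|) := by
      have := mul_le_mul_of_nonneg_left h2 hbn
      rw [hD]; nlinarith
    calc (x ^ 4 / 64 + |b| * x ^ 2 / 8) / r ^ 2 * Real.exp (1 / 6 - |x| / 6)
        ≤ (D * Real.exp (1 / 12 * |x|)) / r ^ 2 * Real.exp (1 / 6 - |x| / 6) := by gcongr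
      _ = D / r ^ 2 * (Real.exp (1 / 12 * |x|) * Real.exp (1 / 6 - |x| / 6)) := by ring
      _ = D / r ^ 2 * (K * Real.exp (-(1 / 12) * |x|)) := by
          rw [hK, ← Real.exp_add, ← Real.exp_add]; ring_nf
  have hprod := abs_prod_sub_prod_le (Finset.univ : Finset ι)
    (f := fun i => coshProfile b r (s i)) (g := fun i => Real.exp (-(s i) ^ 2 / 4))
    (ψ := fun i => K * Real.exp (-(1 / 12) * |s i|)) (ε := D / r ^ 2)
    (fun i => by
      rw [abs_of_nonneg (coshProfile_nonneg _ _ _)]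
      exact (coshProfile_le hr1 hbr _).trans (hψ _))
    (fun i => by
      rw [abs_of_nonneg (Real.exp_pos _).le]
      exact (exp_neg_sq_div_four_le _).trans (hψ _))
    (fun i => hdiff _)
  have hg : ∏ i, Real.exp (-(s i) ^ 2 / 4) ≤ ∏ i, (K * Real.exp (-(1 / 12) * |s i|)) :=
    Finset.prod_le_prod (fun _ _ => (Real.exp_pos _).le)
      fun i _ => (exp_neg_sq_div_four_le _).trans (hψ _)
  have hg0 : 0 ≤ ∏ i, Real.exp (-(s i) ^ 2 / 4) :=
    Finset.prod_nonneg fun _ _ => (Real.exp_pos _).le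
  have hKprod : ∏ i, (K * Real.exp (-(1 / 12) * |s i|)) =
      K ^ Fintype.card ι * ∏ i, Real.exp (-(1 / 12) * |s i|) := by
    rw [Finset.prod_mul_distrib, Finset.prod_const, Finset.card_univ]
  -- Of the decay rate `1 / 6`, half absorbs the polynomials in `s_i`. Of the remaining `1 / 12`,
  -- the tilt and the factor `S²` use at most `1 / 48` each, leaving `1 / 24`.
  have hshift : Real.exp (1 / 24 * |S|) * ∏ i, Real.exp (-(1 / 12) * |s i|) ≤
      ∏ i, Real.exp (-(1 / 24) * |s i|) := by
    calc _ ≤ (∏ i, Real.exp (1 / 24 * |s i|)) * ∏ i, Real.exp (-(1 / 12) * |s i|) := by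
          gcongr
          exact exp_mul_abs_sum_le (by norm_num) s
      _ = _ := by
          rw [← Finset.prod_mul_distrib]
          refine Finset.prod_congr rfl fun i _ => ?_
          rw [← Real.exp_add]; ring_nf
  set P := ∏ i, Real.exp (-(1 / 12) * |s i|) with hP
  set Q := ∏ i, Real.exp (-(1 / 24) * |s i|) with hQ
  have hP0 : 0 ≤ P := Finset.prod_nonneg fun _ _ => (Real.exp_pos _).le
  rw [hKprod] at hprod hg
  have hfac : Real.exp (c / r * S) ≤ Real.exp (1 / 48 * |S|) := by
    rw [Real.exp_le_exp]
    refine (le_abs_self _).trans ?_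
    rw [abs_mul]
    exact mul_le_mul_of_nonneg_right hcr (abs_nonneg _)
  have hfac' : Real.exp |c / r * S| ≤ Real.exp (1 / 48 * |S|) := by
    rw [Real.exp_le_exp, abs_mul]
    exact mul_le_mul_of_nonneg_right hcr (abs_nonneg _)
  have hsq : S ^ 2 ≤ T * Real.exp (1 / 48 * |S|) := by
    rw [← sq_abs]
    exact abs_pow_le_mul_exp 2 (by norm_num) S
  have hfirst : |Real.exp (c / r * S) *
      (∏ i, coshProfile b r (s i) - ∏ i, Real.exp (-(s i) ^ 2 / 4))| ≤
      n * D * K ^ Fintype.card ι / r ^ 2 * Q := by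
    rw [abs_mul, abs_of_pos (Real.exp_pos _)]
    have hle : Real.exp (1 / 48 * |S|) ≤ Real.exp (1 / 24 * |S|) := by
      rw [Real.exp_le_exp]; linarith [abs_nonneg S]
    calc _ ≤ Real.exp (1 / 24 * |S|) * (n * (D / r ^ 2) * (K ^ Fintype.card ι * P)) :=
          mul_le_mul (hfac.trans hle) hprod (abs_nonneg _) (Real.exp_pos _).le
      _ = n * D * K ^ Fintype.card ι / r ^ 2 * (Real.exp (1 / 24 * |S|) * P) := by ring
      _ ≤ _ := mul_le_mul_of_nonneg_left hshift (by positivity)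
  have hsecond : |(Real.exp (c / r * S) - 1 - c / r * S) * ∏ i, Real.exp (-(s i) ^ 2 / 4)| ≤
      c ^ 2 * T * K ^ Fintype.card ι / r ^ 2 * Q := by
    rw [abs_mul, abs_of_nonneg hg0]
    have h1 : |Real.exp (c / r * S) - 1 - c / r * S| ≤
        c ^ 2 * T / r ^ 2 * Real.exp (1 / 24 * |S|) := by
      refine (abs_exp_sub_one_sub_le _).trans ?_
      calc (c / r * S) ^ 2 * Real.exp |c / r * S|
          = c ^ 2 / r ^ 2 * (S ^ 2 * Real.exp |c / r * S|) := by ring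
        _ ≤ c ^ 2 / r ^ 2 *
            (T * Real.exp (1 / 48 * |S|) * Real.exp (1 / 48 * |S|)) := by
            gcongr
        _ = _ := by rw [mul_assoc T, ← Real.exp_add]; ring_nf
    calc _ ≤ c ^ 2 * T / r ^ 2 * Real.exp (1 / 24 * |S|) * (K ^ Fintype.card ι * P) :=
          mul_le_mul h1 hg hg0 (by positivity)
      _ = c ^ 2 * T * K ^ Fintype.card ι / r ^ 2 * (Real.exp (1 / 24 * |S|) * P) := by ring
      _ ≤ _ := mul_le_mul_of_nonneg_left hshift (by positivity)
  calc _ = |Real.exp (c / r * S) *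
      (∏ i, coshProfile b r (s i) - ∏ i, Real.exp (-(s i) ^ 2 / 4)) +
      (Real.exp (c / r * S) - 1 - c / r * S) * ∏ i, Real.exp (-(s i) ^ 2 / 4)| := by
        congr 1; ring
    _ ≤ _ := abs_add_le _ _
    _ ≤ _ := add_le_add hfirst hsecond
    _ = _ := by ring

/-! ### Gaussian integrals of functions of the coordinate sum. -/

section Gaussian

open ProbabilityTheory

/-- A finite product of measures with densities has the product density. -/
lemma pi_withDensity_ofReal {ι : Type*} [Fintype ι] {f : ℝ → ℝ} (hf : Integrable f)
    (hf0 : ∀ x, 0 ≤ f x) :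
    Measure.pi (fun _ : ι => volume.withDensity fun x => ENNReal.ofReal (f x)) =
      (volume : Measure (ι → ℝ)).withDensity fun x => ENNReal.ofReal (∏ i, f (x i)) := by
  have : IsFiniteMeasure (volume.withDensity fun x => ENNReal.ofReal (f x)) :=
    isFiniteMeasure_withDensity_ofReal hf.2
  refine (Measure.pi_eq fun s hs => ?_)
  have hint : Integrable (fun x : ι → ℝ => ∏ i, f (x i)) := Integrable.fintype_prod fun _ => hf
  rw [withDensity_apply _ (MeasurableSet.univ_pi hs),
    ← ofReal_integral_eq_lintegral_ofReal hint.integrableOn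
      (Eventually.of_forall fun x => Finset.prod_nonneg fun i _ => hf0 _),
    ← integral_indicator (MeasurableSet.univ_pi hs)]
  have h1 : (Set.univ.pi s).indicator (fun x : ι → ℝ => ∏ i, f (x i)) =
      fun x => ∏ i, (s i).indicator f (x i) := by
    ext x
    by_cases hx : x ∈ Set.univ.pi s
    · rw [Set.indicator_of_mem hx]
      exact Finset.prod_congr rfl fun i _ => (Set.indicator_of_mem (hx i trivial) _).symm
    · rw [Set.indicator_of_notMem hx]
      simp only [Set.mem_univ_pi, not_forall] at hx
      obtain ⟨i, hi⟩ := hx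
      exact (Finset.prod_eq_zero (Finset.mem_univ i) (Set.indicator_of_notMem hi _)).symm
  rw [h1, integral_fintype_prod_volume_eq_prod (fun i => (s i).indicator f),
    ENNReal.ofReal_prod_of_nonneg
      fun i _ => integral_nonneg fun x => Set.indicator_nonneg (fun y _ => hf0 y) x]
  refine Finset.prod_congr rfl fun i _ => ?_
  rw [withDensity_apply _ (hs i), integral_indicator (hs i),
    ofReal_integral_eq_lintegral_ofReal hf.integrableOn (Eventually.of_forall hf0)]

/-- A sum of independent centered Gaussians of the same variance is Gaussian. -/
lemma map_sum_pi_gaussianReal (ι : Type*) [Fintype ι] (v : NNReal) :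
    (Measure.pi fun _ : ι => gaussianReal 0 v).map (fun x => ∑ i, x i) =
      gaussianReal 0 (Fintype.card ι * v) := by
  have : IsFiniteMeasure ((Measure.pi fun _ : ι => gaussianReal 0 v).map fun x => ∑ i, x i) :=
    inferInstance
  refine Measure.ext_of_charFun ?_
  rw [charFun_map_sum_pi_eq_prod]
  ext t
  simp only [Finset.prod_const, Pi.pow_apply, charFun_gaussianReal, ← Complex.exp_nat_mul,
    Finset.card_univ]
  push_cast
  ring_nf

lemma exp_neg_sq_div_four_eq (x : ℝ) :
    Real.exp (-x ^ 2 / 4) = √(4 * Real.pi) * gaussianPDFReal 0 2 x := by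
  rw [gaussianPDFReal_def]
  have : (2 : ℝ) * Real.pi * (2 : NNReal) = 4 * Real.pi := by push_cast; ring
  have h0 : √(4 * Real.pi) ≠ 0 := by positivity
  rw [this]
  simp only [sub_zero]
  rw [← mul_assoc, mul_inv_cancel₀ h0, one_mul]
  congr 1
  push_cast
  ring

/-- The integral of a function of the sum of coordinates against a Gaussian product density. -/
lemma integral_comp_sum_mul_prod_exp (ι : Type*) [Fintype ι] {F : ℝ → ℝ} (hF : Measurable F) :
    ∫ x : ι → ℝ, F (∑ i, x i) * ∏ i, Real.exp (-(x i) ^ 2 / 4) =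
      √(4 * Real.pi) ^ Fintype.card ι *
        ∫ y, F y ∂(gaussianReal 0 (Fintype.card ι * 2)) := by
  rw [← map_sum_pi_gaussianReal ι 2,
    integral_map (Measurable.aemeasurable (by fun_prop)) hF.aestronglyMeasurable,
    gaussianReal_of_var_ne_zero 0 (two_ne_zero)]
  unfold gaussianPDF
  rw [pi_withDensity_ofReal (ι := ι) (integrable_gaussianPDFReal 0 2)
    (gaussianPDFReal_nonneg 0 2)]
  rw [integral_withDensity_eq_integral_toReal_smul
    (by
      refine Measurable.ennreal_ofReal (Finset.measurable_prod _ fun i _ => ?_)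
      exact (measurable_gaussianPDFReal 0 2).comp (measurable_pi_apply i))
    (Eventually.of_forall fun _ => ENNReal.ofReal_lt_top), ← integral_const_mul]
  refine integral_congr_ae (Eventually.of_forall fun x => ?_)
  simp only [exp_neg_sq_div_four_eq, Finset.prod_mul_distrib, Finset.prod_const, Finset.card_univ,
    smul_eq_mul]
  rw [ENNReal.toReal_ofReal (Finset.prod_nonneg fun i _ => gaussianPDFReal_nonneg 0 2 _)]
  ring

lemma integral_indicator_Ioi_gaussianReal {v : NNReal} (hv : v ≠ 0) :
    ∫ y, (Set.Ioi 0).indicator (fun _ => (1 : ℝ)) y ∂(gaussianReal 0 v) = 1 / 2 := by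
  have hv' : (0 : ℝ) < v := by positivity
  rw [integral_gaussianReal_eq_integral_smul hv]
  have : ∀ y, gaussianPDFReal 0 v y • (Set.Ioi 0).indicator (fun _ => (1 : ℝ)) y =
      (Set.Ioi 0).indicator
        (fun y => (√(2 * Real.pi * v))⁻¹ * Real.exp (-(1 / (2 * v)) * y ^ 2)) y := by
    intro y
    by_cases hy : y ∈ Set.Ioi (0 : ℝ)
    · rw [Set.indicator_of_mem hy, Set.indicator_of_mem hy, gaussianPDFReal_def]
      simp only [sub_zero, smul_eq_mul, mul_one]
      congr 2
      ring
    · rw [Set.indicator_of_notMem hy, Set.indicator_of_notMem hy, smul_zero]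
  simp_rw [this]
  rw [integral_indicator measurableSet_Ioi, integral_const_mul, integral_gaussian_Ioi]
  have e : Real.pi / (1 / (2 * (v : ℝ))) = 2 * Real.pi * v := by field_simp
  rw [e]
  have h0 : √(2 * Real.pi * v) ≠ 0 := by positivity
  field_simp

lemma integral_indicator_Ioi_id_gaussianReal {v : NNReal} (hv : v ≠ 0) :
    ∫ y, (Set.Ioi 0).indicator (fun y => (y : ℝ)) y ∂(gaussianReal 0 v) =
      √(v / (2 * Real.pi)) := by
  have hv' : (0 : ℝ) < v := by positivity
  rw [integral_gaussianReal_eq_integral_smul hv]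
  have : ∀ y, gaussianPDFReal 0 v y • (Set.Ioi 0).indicator (fun y => (y : ℝ)) y =
      (Set.Ioi 0).indicator
        (fun y => (√(2 * Real.pi * v))⁻¹ *
          (y ^ (1 : ℝ) * Real.exp (-(1 / (2 * v)) * y ^ (2 : ℝ)))) y := by
    intro y
    by_cases hy : y ∈ Set.Ioi (0 : ℝ)
    · rw [Set.indicator_of_mem hy, Set.indicator_of_mem hy, gaussianPDFReal_def]
      simp only [sub_zero, smul_eq_mul, Real.rpow_one, Real.rpow_two]
      rw [mul_assoc, mul_comm y]
      congr 3
      ring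
    · rw [Set.indicator_of_notMem hy, Set.indicator_of_notMem hy, smul_zero]
  simp_rw [this]
  rw [integral_indicator measurableSet_Ioi, integral_const_mul,
    integral_rpow_mul_exp_neg_mul_rpow (by norm_num) (by norm_num) (by positivity)]
  norm_num
  have h1 : (v : ℝ) = √v ^ 2 := (Real.sq_sqrt hv'.le).symm
  have h2 : √(v : ℝ) ≠ 0 := by positivity
  have h3 : √Real.pi ≠ 0 := by positivity
  rw [Real.rpow_neg_one, show ((v : ℝ)⁻¹ * (1 / 2))⁻¹ * (1 / 2) = √v ^ 2 by rw [← h1]; field_simp]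
  field_simp

end Gaussian

/-! ### Logarithmic variables and reduction to a half-space integral. -/

/-- The factor contributed by each logarithmic variable to the `m`-fold integral. -/
noncomputable def logFactor (j k t : ℝ) : ℝ :=
  Real.exp (k * t) / (1 + Real.exp t) ^ (j + k - 1 / 2)

lemma logFactor_eq_cosh (j k t : ℝ) :
    logFactor j k t = 2 ^ (-(j + k - 1 / 2)) * Real.exp (((k - j) / 2 + 1 / 4) * t) *
      Real.cosh (t / 2) ^ (-(j + k - 1 / 2)) := by
  have h1 : 1 + Real.exp t = 2 * Real.cosh (t / 2) * Real.exp (t / 2) := by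
    have e1 : Real.exp (t / 2) * Real.exp (t / 2) = Real.exp t := by
      rw [← Real.exp_add]; ring_nf
    have e2 : Real.exp (-(t / 2)) * Real.exp (t / 2) = 1 := by
      rw [← Real.exp_add]; simp
    rw [Real.cosh_eq]
    linear_combination -e1 - e2
  have hc := Real.cosh_pos (t / 2)
  rw [logFactor, h1, Real.mul_rpow (by positivity) (Real.exp_pos _).le,
    Real.mul_rpow two_pos.le hc.le, Real.rpow_neg two_pos.le, Real.rpow_neg hc.le, ← Real.exp_mul]
  have e : Real.exp (k * t) =
      Real.exp (((k - j) / 2 + 1 / 4) * t) * Real.exp (t / 2 * (j + k - 1 / 2)) := by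
    rw [← Real.exp_add]; ring_nf
  have h2 : (2 : ℝ) ^ (j + k - 1 / 2) ≠ 0 := by positivity
  have h3 : Real.cosh (t / 2) ^ (j + k - 1 / 2) ≠ 0 := by positivity
  rw [e]
  field_simp

/-- Identifies the kernel in `x_l / x_{l+1}` with the same factor that `x_1` contributes, read at
the opposite logarithm; the shift from `k` to `j - 1 / 2` is what makes all factors identical. -/
lemma logFactor_neg (j k u : ℝ) :
    logFactor j k (-u) =
      Real.exp u ^ (j - 1 / 2) / (1 + Real.exp u) ^ (j + k - 1 / 2) := by
  have hu := Real.exp_pos u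
  have h1 : 1 + Real.exp (-u) = (1 + Real.exp u) / Real.exp u := by
    rw [Real.exp_neg]; field_simp; ring
  rw [logFactor, h1, Real.div_rpow (by positivity) hu.le, ← Real.exp_mul, ← Real.exp_mul,
    div_div_eq_mul_div, ← Real.exp_add]
  ring_nf

/-- Exponential change of variables on a finite product of lines. -/
lemma integral_image_exp_pi {n : ℕ} {s : Set (Fin n → ℝ)} (hs : MeasurableSet s)
    (f : (Fin n → ℝ) → ℝ) :
    ∫ x in (fun y i => Real.exp (y i)) '' s, f x =
      ∫ y in s, (∏ i, Real.exp (y i)) * f fun i => Real.exp (y i) := by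
  have hderiv : ∀ y ∈ s, HasFDerivWithinAt (fun (y : Fin n → ℝ) i => Real.exp (y i))
      (ContinuousLinearMap.pi fun i => Real.exp (y i) •
        ContinuousLinearMap.proj (R := ℝ) (φ := fun _ : Fin n => ℝ) i) s y := by
    intro y _
    rw [hasFDerivWithinAt_pi]
    intro i
    exact (((ContinuousLinearMap.proj (R := ℝ) (φ := fun _ : Fin n => ℝ) i).hasFDerivAt
      (x := y)).exp).hasFDerivWithinAt
  rw [integral_image_eq_integral_abs_det_fderiv_smul volume hs hderiv
    (fun y _ z _ h => funext fun i => Real.exp_injective (congrFun h i))]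
  refine integral_congr_ae (Eventually.of_forall fun y => ?_)
  have hdet : (ContinuousLinearMap.pi fun i => Real.exp (y i) •
      ContinuousLinearMap.proj (R := ℝ) (φ := fun _ : Fin n => ℝ) i).det =
      ∏ i, Real.exp (y i) := by
    rw [← Matrix.det_diagonal, ← LinearMap.det_toLin']
    unfold ContinuousLinearMap.det
    congr 1
    ext v i
    simp [Matrix.toLin'_apply, Matrix.mulVec_diagonal]
  simp only [smul_eq_mul]
  rw [hdet, abs_of_nonneg (Finset.prod_nonneg fun i _ => (Real.exp_pos _).le)]

/-- Taking partial sums preserves Lebesgue measure. -/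
lemma measurePreserving_partialSums (n : ℕ) :
    MeasurePreserving (fun (t : Fin n → ℝ) i => ∑ l ∈ Finset.univ.filter (· ≤ i), t l) := by
  let M : Matrix (Fin n) (Fin n) ℝ := Matrix.of fun i l => if l ≤ i then 1 else 0
  -- The matrix is lower triangular with unit diagonal.
  have hM : M.det = 1 := by
    rw [Matrix.det_of_isLowerTriangular]
    · simp [M]
    · intro i l hil
      simp only [OrderDual.toDual_lt_toDual] at hil
      simp [M, not_le.2 hil]
  have hfun : (fun (t : Fin n → ℝ) i => ∑ l ∈ Finset.univ.filter (· ≤ i), t l) =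
      Matrix.toLin' M := by
    ext t i
    simp [M, Matrix.toLin'_apply, Matrix.mulVec, dotProduct, Finset.sum_filter]
  rw [hfun]
  refine ⟨(LinearMap.continuous_on_pi _).measurable, ?_⟩
  rw [Real.map_matrix_volume_pi_eq_smul_volume_pi (by rw [hM]; exact one_ne_zero), hM]
  simp

lemma foldDomain_eq_image_exp (n : ℕ) :
    foldDomain n = (fun y i => Real.exp (y i)) '' {y : Fin (n + 1) → ℝ | 0 < y (Fin.last n)} := by
  ext x
  constructor
  · rintro ⟨hx, hx1⟩
    exact ⟨fun i => Real.log (x i), Real.log_pos hx1, funext fun i => Real.exp_log (hx i)⟩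
  · rintro ⟨y, hy, rfl⟩
    exact ⟨fun i => Real.exp_pos _, Real.one_lt_exp_iff.2 hy⟩

lemma prod_exp_mul_foldIntegrand (n : ℕ) (j k : ℝ) (y : Fin (n + 1) → ℝ) :
    (∏ i, Real.exp (y i)) * foldIntegrand n j k (fun i => Real.exp (y i)) =
      logFactor j k (y 0) * ∏ l : Fin n, logFactor j k (y l.succ - y l.castSucc) := by
  have h1 : (∏ i, Real.exp (y i)) * ∏ i, 1 / Real.exp (y i) = 1 := by
    rw [← Finset.prod_mul_distrib]
    exact Finset.prod_eq_one fun i _ => mul_one_div_cancel (Real.exp_pos _).ne'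
  have h2 : ∀ l : Fin n, logFactor j k (y l.succ - y l.castSucc) =
      (Real.exp (y l.castSucc) / Real.exp (y l.succ)) ^ (j - 1 / 2) /
        (1 + Real.exp (y l.castSucc) / Real.exp (y l.succ)) ^ (j + k - 1 / 2) := by
    intro l
    rw [← neg_sub, logFactor_neg, Real.exp_sub]
  simp only [h2, foldIntegrand]
  rw [← mul_assoc, ← mul_assoc, h1, one_mul, mul_comm, logFactor, mul_comm k, Real.exp_mul]

/-- In logarithmic difference variables the `m`-fold integral becomes the integral of a product
over a half space. -/
lemma foldIntegral_eq_setIntegral_prod (n : ℕ) (j k : ℝ) :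
    foldIntegral (n + 1) j k =
      ∫ t in {t : Fin (n + 1) → ℝ | 0 < ∑ i, t i}, ∏ i, logFactor j k (t i) := by
  have hs : MeasurableSet {y : Fin (n + 1) → ℝ | 0 < y (Fin.last n)} :=
    measurableSet_lt measurable_const (measurable_pi_apply _)
  have ht : MeasurableSet {t : Fin (n + 1) → ℝ | 0 < ∑ i, t i} :=
    measurableSet_lt measurable_const (by fun_prop)
  rw [foldIntegral, foldDomain_eq_image_exp, integral_image_exp_pi hs,
    ← integral_indicator hs, ← integral_indicator ht]
  simp only [prod_exp_mul_foldIntegrand]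
  have hmp := measurePreserving_partialSums (n + 1)
  rw [← hmp.map_eq, integral_map hmp.measurable.aemeasurable]
  · rw [hmp.map_eq]
    refine integral_congr_ae (Eventually.of_forall fun t => ?_)
    have hlast : ∑ l ∈ Finset.univ.filter (· ≤ Fin.last n), t l = ∑ l, t l := by
      simp [Fin.le_last]
    have hzero : ∑ l ∈ Finset.univ.filter (· ≤ (0 : Fin (n + 1))), t l = t 0 := by
      simp [Finset.sum_filter]
    have hdiff : ∀ l : Fin n, ∑ i ∈ Finset.univ.filter (· ≤ l.succ), t i -
        ∑ i ∈ Finset.univ.filter (· ≤ l.castSucc), t i = t l.succ := by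
      intro l
      have : Finset.univ.filter (· ≤ l.succ) =
          insert l.succ (Finset.univ.filter (· ≤ l.castSucc)) := by
        ext i
        simp only [Finset.mem_filter, Finset.mem_univ, true_and, Finset.mem_insert, Fin.ext_iff,
          Fin.le_def, Fin.val_succ, Fin.val_castSucc]
        omega
      rw [this, Finset.sum_insert (by simp [Fin.le_def]), add_sub_cancel_right]
    simp only [Set.indicator_apply, Set.mem_ofPred_eq, hlast, hzero, hdiff, Fin.prod_univ_succ]
  · refine (Measurable.indicator ?_ hs).aestronglyMeasurable
    unfold logFactor
    fun_prop

/-! ### Expansion of the rescaled integral. -/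

/-- The rescaled `m`-fold integral, a half-space integral of an exponentially tilted product. -/
noncomputable def tiltedIntegral (ι : Type*) [Fintype ι] (b c r : ℝ) : ℝ :=
  ∫ s in {s : ι → ℝ | 0 < ∑ i, s i},
    Real.exp (c / r * ∑ i, s i) * ∏ i, coshProfile b r (s i)

lemma integrable_exp_neg_mul_abs {δ : ℝ} (hδ : 0 < δ) :
    Integrable fun x : ℝ => Real.exp (-δ * |x|) := by
  rw [← integrableOn_univ, ← Set.Iic_union_Ioi (a := (0 : ℝ)), integrableOn_union]
  constructor
  · refine (integrableOn_exp_mul_Iic hδ 0).congr_fun (fun x hx => ?_) measurableSet_Iic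
    simp only [abs_of_nonpos (Set.mem_Iic.1 hx), neg_mul_neg]
  · refine (integrableOn_exp_mul_Ioi (neg_neg_of_pos hδ) 0).congr_fun (fun x hx => ?_)
      measurableSet_Ioi
    simp only [abs_of_pos (Set.mem_Ioi.1 hx)]

lemma measurableSet_sum_pos (ι : Type*) [Fintype ι] :
    MeasurableSet {s : ι → ℝ | 0 < ∑ i, s i} :=
  measurableSet_lt measurable_const (by fun_prop)

lemma integrable_one_add_mul_sum_mul_prod (ι : Type*) [Fintype ι] (a : ℝ) :
    Integrable fun s : ι → ℝ => (1 + a * ∑ i, s i) * ∏ i, Real.exp (-(s i) ^ 2 / 4) := by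
  have hdom : Integrable fun s : ι → ℝ => (1 + |a|) * Real.exp (1 / 6) ^ Fintype.card ι *
      (48 * ∏ i, Real.exp (-(1 / 12) * |s i|)) := by
    refine Integrable.const_mul (Integrable.const_mul ?_ _) _
    exact Integrable.fintype_prod fun _ => integrable_exp_neg_mul_abs (by norm_num)
  refine hdom.mono' (Continuous.aestronglyMeasurable (by fun_prop))
    (Eventually.of_forall fun s => ?_)
  set S := ∑ i, s i
  have hg0 : 0 ≤ ∏ i, Real.exp (-(s i) ^ 2 / 4) :=
    Finset.prod_nonneg fun _ _ => (Real.exp_pos _).le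
  -- From `1 + u ≤ exp u` one gets `|S| ≤ 12 exp (|S| / 12)`, so `48` is a generous constant.
  have h1 : |1 + a * S| ≤ (1 + |a|) * (48 * Real.exp (1 / 12 * |S|)) := by
    have e1 := Real.add_one_le_exp (1 / 12 * |S|)
    have e2 : |1 + a * S| ≤ 1 + |a| * |S| := by
      refine (abs_add_le _ _).trans ?_
      rw [abs_one, abs_mul]
    nlinarith [abs_nonneg a, abs_nonneg S, mul_nonneg (abs_nonneg a) (abs_nonneg S),
      mul_le_mul_of_nonneg_left e1 (abs_nonneg a)]
  have h2 : Real.exp (1 / 12 * |S|) * ∏ i, Real.exp (-(s i) ^ 2 / 4) ≤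
      Real.exp (1 / 6) ^ Fintype.card ι * ∏ i, Real.exp (-(1 / 12) * |s i|) := by
    refine (mul_le_mul_of_nonneg_right (exp_mul_abs_sum_le (by norm_num) s) hg0).trans ?_
    rw [← Finset.card_univ, ← Finset.prod_const, ← Finset.prod_mul_distrib,
      ← Finset.prod_mul_distrib]
    refine Finset.prod_le_prod (fun i _ => by positivity) fun i _ => ?_
    refine (mul_le_mul_of_nonneg_left (exp_neg_sq_div_four_le _) (Real.exp_pos _).le).trans ?_
    rw [← Real.exp_add, ← Real.exp_add]
    exact Real.exp_le_exp.2 (by ring_nf; rfl)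
  rw [Real.norm_eq_abs, abs_mul, abs_of_nonneg hg0]
  calc _ ≤ (1 + |a|) * (48 * Real.exp (1 / 12 * |S|)) * ∏ i, Real.exp (-(s i) ^ 2 / 4) :=
        mul_le_mul_of_nonneg_right h1 hg0
    _ = (1 + |a|) * 48 * (Real.exp (1 / 12 * |S|) * ∏ i, Real.exp (-(s i) ^ 2 / 4)) := by ring
    _ ≤ (1 + |a|) * 48 *
        (Real.exp (1 / 6) ^ Fintype.card ι * ∏ i, Real.exp (-(1 / 12) * |s i|)) :=
        mul_le_mul_of_nonneg_left h2 (by positivity)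
    _ = _ := by ring

-- After normalization `S` has law `N(0, 2m)` with `m` the cardinality of `ι`, so `S > 0` has
-- probability `1 / 2` and the first moment there is `√(2m / (2π)) = √(m / π)`. Nonemptiness keeps
-- the variance nonzero.
open ProbabilityTheory in
lemma setIntegral_one_add_mul_sum_mul_prod (ι : Type*) [Fintype ι] [Nonempty ι] (a : ℝ) :
    ∫ s in {s : ι → ℝ | 0 < ∑ i, s i},
      (1 + a * ∑ i, s i) * ∏ i, Real.exp (-(s i) ^ 2 / 4) =
    √(4 * Real.pi) ^ Fintype.card ι * (1 / 2 + a * √(Fintype.card ι / Real.pi)) := by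
  have hv : (Fintype.card ι : NNReal) * 2 ≠ 0 := by simp
  have hF : ∀ s : ι → ℝ, {s : ι → ℝ | 0 < ∑ i, s i}.indicator
      (fun s => (1 + a * ∑ i, s i) * ∏ i, Real.exp (-(s i) ^ 2 / 4)) s =
      (Set.Ioi (0 : ℝ)).indicator (fun y => 1 + a * y) (∑ i, s i) *
        ∏ i, Real.exp (-(s i) ^ 2 / 4) := by
    intro s
    simp only [Set.indicator_apply, Set.mem_ofPred_eq, Set.mem_Ioi]
    split_ifs <;> simp
  rw [← integral_indicator (measurableSet_sum_pos ι)]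
  simp_rw [hF]
  rw [integral_comp_sum_mul_prod_exp ι
    (Measurable.indicator (by fun_prop) measurableSet_Ioi)]
  have hsplit : ∀ y : ℝ, (Set.Ioi (0 : ℝ)).indicator (fun y => 1 + a * y) y =
      (Set.Ioi 0).indicator (fun _ => (1 : ℝ)) y +
        a * (Set.Ioi 0).indicator (fun y => (y : ℝ)) y := by
    intro y
    simp only [Set.indicator_apply]
    split_ifs <;> simp
  simp_rw [hsplit]
  have hid : Integrable (fun y : ℝ => y) (gaussianReal 0 (Fintype.card ι * 2)) :=
    (memLp_id_gaussianReal 1).integrable le_rfl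
  rw [integral_add ((integrable_const _).indicator measurableSet_Ioi)
    ((hid.indicator measurableSet_Ioi).const_mul a), integral_const_mul,
    integral_indicator_Ioi_gaussianReal hv, integral_indicator_Ioi_id_gaussianReal hv]
  congr 4
  push_cast
  field_simp

/-- First order expansion of the rescaled integral. -/
lemma exists_abs_tiltedIntegral_sub_le (ι : Type*) [Fintype ι] [Nonempty ι] (b c : ℝ) :
    ∃ C R : ℝ, 1 ≤ R ∧ ∀ r, R ≤ r →
      |tiltedIntegral ι b c r - √(4 * Real.pi) ^ Fintype.card ι *
        (1 / 2 + c / r * √(Fintype.card ι / Real.pi))| ≤ C / r ^ 2 := by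
  obtain ⟨C, R, hR, h⟩ := exists_abs_tilted_prod_sub_le ι b c
  refine ⟨C * ∫ s in {s : ι → ℝ | 0 < ∑ i, s i}, ∏ i, Real.exp (-(1 / 24) * |s i|), R, hR,
    fun r hr => ?_⟩
  have hB : Integrable fun s : ι → ℝ => C / r ^ 2 * ∏ i, Real.exp (-(1 / 24) * |s i|) :=
    (Integrable.fintype_prod fun _ => integrable_exp_neg_mul_abs (by norm_num)).const_mul _
  have hG := integrable_one_add_mul_sum_mul_prod ι (c / r)
  have hcont := continuous_coshProfile b r
  have hD : Integrable fun s : ι → ℝ =>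
      Real.exp (c / r * ∑ i, s i) * ∏ i, coshProfile b r (s i) -
        (1 + c / r * ∑ i, s i) * ∏ i, Real.exp (-(s i) ^ 2 / 4) :=
    hB.mono' (Continuous.aestronglyMeasurable (by fun_prop)) (Eventually.of_forall (h r hr))
  -- Integrability of the tilted product needs no separate estimate: it is an integrable Gaussian
  -- term plus the dominated difference.
  have hF : Integrable fun s : ι → ℝ =>
      Real.exp (c / r * ∑ i, s i) * ∏ i, coshProfile b r (s i) := by
    exact (hD.add hG).congr (Eventually.of_forall fun s => sub_add_cancel _ _)
  rw [tiltedIntegral, ← setIntegral_one_add_mul_sum_mul_prod,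
    ← integral_sub hF.integrableOn hG.integrableOn]
  rw [← Real.norm_eq_abs]
  refine (norm_integral_le_of_norm_le (g := fun s : ι → ℝ =>
    C / r ^ 2 * ∏ i, Real.exp (-(1 / 24) * |s i|)) hB.integrableOn
    (Eventually.of_forall fun s => h r hr s)).trans_eq ?_
  rw [integral_const_mul]
  ring

/-- Substituting `t = s / r` gives the Jacobian `r ^ (-(n + 1))` and one power of `2` per factor;
the identity is exact, so all approximation lies in `tiltedIntegral`. -/
lemma foldIntegral_eq_tiltedIntegral (n : ℕ) {r : ℝ} (hr : 0 < r) (l₁ l₂ : ℝ) :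
    foldIntegral (n + 1) (r ^ 2 + l₁) (r ^ 2 + l₂) =
      (r ^ (n + 1))⁻¹ * (2 ^ (-(2 * r ^ 2 + (l₁ + l₂ - 1 / 2)))) ^ (n + 1) *
        tiltedIntegral (Fin (n + 1)) (l₁ + l₂ - 1 / 2) ((l₂ - l₁) / 2 + 1 / 4) r := by
  set b := l₁ + l₂ - 1 / 2 with hb
  set c := (l₂ - l₁) / 2 + 1 / 4 with hc
  have hS := measurableSet_sum_pos (Fin (n + 1))
  have hscale := Measure.integral_comp_smul (volume : Measure (Fin (n + 1) → ℝ))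
    ({t : Fin (n + 1) → ℝ | 0 < ∑ i, t i}.indicator
      fun t => ∏ i, logFactor (r ^ 2 + l₁) (r ^ 2 + l₂) (t i)) r⁻¹
  rw [foldIntegral_eq_setIntegral_prod, ← integral_indicator hS]
  have hpt : ∀ s : Fin (n + 1) → ℝ, {t : Fin (n + 1) → ℝ | 0 < ∑ i, t i}.indicator
      (fun t => ∏ i, logFactor (r ^ 2 + l₁) (r ^ 2 + l₂) (t i)) (r⁻¹ • s) =
      (2 ^ (-(2 * r ^ 2 + b))) ^ (n + 1) * {t : Fin (n + 1) → ℝ | 0 < ∑ i, t i}.indicator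
        (fun s => Real.exp (c / r * ∑ i, s i) * ∏ i, coshProfile b r (s i)) s := by
    intro s
    have hiff : 0 < ∑ i, (r⁻¹ • s) i ↔ 0 < ∑ i, s i := by
      simp only [Pi.smul_apply, smul_eq_mul, ← Finset.mul_sum]
      exact mul_pos_iff_of_pos_left (inv_pos.2 hr)
    have hfac : ∀ i, logFactor (r ^ 2 + l₁) (r ^ 2 + l₂) ((r⁻¹ • s) i) =
        2 ^ (-(2 * r ^ 2 + b)) * (Real.exp (c / r * s i) * coshProfile b r (s i)) := by
      intro i
      have e1 : r ^ 2 + l₁ + (r ^ 2 + l₂) - 1 / 2 = 2 * r ^ 2 + b := by rw [hb]; ring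
      have e2 : (r⁻¹ • s) i / 2 = s i / (2 * r) := by
        simp only [Pi.smul_apply, smul_eq_mul]; field_simp
      have e3 : ((r ^ 2 + l₂ - (r ^ 2 + l₁)) / 2 + 1 / 4) * (r⁻¹ • s) i = c / r * s i := by
        simp only [Pi.smul_apply, smul_eq_mul]; rw [hc]; ring
      rw [logFactor_eq_cosh, e1, e2, e3, coshProfile, mul_assoc]
    simp only [Set.indicator_apply, Set.mem_ofPred_eq, hiff]
    split_ifs
    · simp only [hfac, Finset.prod_mul_distrib, Finset.prod_const, Finset.card_univ,
        Fintype.card_fin, ← Real.exp_sum, Finset.mul_sum]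
    · simp
  simp_rw [hpt] at hscale
  rw [integral_const_mul, integral_indicator hS, Module.finrank_fin_fun, smul_eq_mul,
    abs_of_pos (by positivity), inv_pow, inv_inv] at hscale
  rw [mul_assoc, tiltedIntegral, hscale, ← mul_assoc, inv_mul_cancel₀ (by positivity), one_mul]

/-! ### Matching of constants. -/

theorem mainTheorem3 (m : ℕ) (hm : 1 ≤ m) (l₁ l₂ : ℝ) :
    ∃ E : ℕ → ℝ, E =O[atTop] (fun j : ℕ => 1 / (j : ℝ)) ∧
      ∀ᶠ j : ℕ in atTop,
        foldIntegral m ((j : ℝ) + l₁) ((j : ℝ) + l₂) =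
          (j : ℝ) ^ (-(m : ℝ) / 2) * (4 : ℝ) ^ (-(m : ℝ) * (j : ℝ)) *
            (2 : ℝ) ^ (-(m : ℝ) * (l₁ + l₂ - 2)) *
            (coeffZero m + coeffOne l₁ l₂ m * (j : ℝ) ^ (-1 / 2 : ℝ) + E j) := by
  obtain ⟨n, rfl⟩ : ∃ n, m = n + 1 := ⟨m - 1, by omega⟩
  set M : ℝ := ((n + 1 : ℕ) : ℝ) with hMdef
  have hM0 : 0 < M := by positivity
  set b := l₁ + l₂ - 1 / 2 with hb
  set c := (l₂ - l₁) / 2 + 1 / 4 with hc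
  obtain ⟨C, R, hR, hbound⟩ := exists_abs_tiltedIntegral_sub_le (Fin (n + 1)) b c
  rw [Fintype.card_fin] at hbound
  have hpi := Real.pi_pos
  have hpow : √(4 * Real.pi) ^ (n + 1) = Real.pi ^ (M / 2) * 2 ^ M := by
    rw [← Real.rpow_natCast, ← hMdef, show (4 : ℝ) * Real.pi = 2 ^ 2 * Real.pi by norm_num,
      Real.sqrt_mul (by positivity), Real.sqrt_sq two_pos.le,
      Real.mul_rpow two_pos.le (Real.sqrt_nonneg _), Real.sqrt_eq_rpow, ← Real.rpow_mul hpi.le]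
    ring_nf
  have h2 : (2 : ℝ) ^ (-(3 * M / 2)) * 2 ^ M = 2 * 2 ^ (-M / 2 - 1) := by
    rw [← Real.rpow_add two_pos, ← Real.rpow_one_add' two_pos.le (by linarith)]
    ring_nf
  have hzero : (2 : ℝ) ^ (-(3 * M / 2)) * (√(4 * Real.pi) ^ (n + 1) * (1 / 2)) =
      coeffZero (n + 1) := by
    rw [coeffZero, hpow, ← hMdef]
    linear_combination Real.pi ^ (M / 2) / 2 * h2
  have hsqrt : Real.pi ^ (M / 2) * √(M / Real.pi) =
      Real.pi ^ ((M - 1) / 2) * M ^ (1 / 2 : ℝ) := by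
    rw [Real.sqrt_eq_rpow, Real.div_rpow hM0.le hpi.le, sub_div, Real.rpow_sub hpi]
    ring
  have hone : (2 : ℝ) ^ (-(3 * M / 2)) *
      (√(4 * Real.pi) ^ (n + 1) * (c * √(M / Real.pi))) = coeffOne l₁ l₂ (n + 1) := by
    rw [coeffOne, hpow, ← hMdef]
    calc _ = (2 ^ (-(3 * M / 2)) * 2 ^ M) * (Real.pi ^ (M / 2) * √(M / Real.pi)) * c := by ring
      _ = _ := by rw [h2, hsqrt, hc]; ring
  -- The error is the exact remainder. The factor `2 ^ (-3M / 2)` is the discrepancy between `2 ^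
  -- (-M b)`, with `b = l₁ + l₂ - 1 / 2`, and the normalization `2 ^ (-M (l₁ + l₂ - 2))`.
  refine ⟨fun j => (2 : ℝ) ^ (-(3 * M / 2)) * tiltedIntegral (Fin (n + 1)) b c √(j : ℝ) -
    (coeffZero (n + 1) + coeffOne l₁ l₂ (n + 1) * (j : ℝ) ^ (-1 / 2 : ℝ)), ?_, ?_⟩
  · refine IsBigO.of_bound ((2 : ℝ) ^ (-(3 * M / 2)) * C) ?_
    filter_upwards [eventually_ge_atTop (Nat.ceil (R ^ 2))] with j hj
    have hjR : R ^ 2 ≤ (j : ℝ) := (Nat.le_ceil _).trans (by exact_mod_cast hj)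
    have hj0 : (0 : ℝ) < j := by nlinarith
    have hr : R ≤ √(j : ℝ) := Real.le_sqrt_of_sq_le hjR
    have h := hbound _ hr
    rw [Real.sq_sqrt hj0.le] at h
    have hj2 : (j : ℝ) ^ (-1 / 2 : ℝ) = 1 / √(j : ℝ) := by
      rw [neg_div, Real.rpow_neg hj0.le, ← Real.sqrt_eq_rpow, inv_eq_one_div]
    rw [hj2, ← hzero, ← hone, Real.norm_of_nonneg (by positivity : 0 ≤ 1 / (j : ℝ)),
      Real.norm_eq_abs]
    calc _ = |2 ^ (-(3 * M / 2)) * (tiltedIntegral (Fin (n + 1)) b c √(j : ℝ) -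
          √(4 * Real.pi) ^ (n + 1) * (1 / 2 + c / √(j : ℝ) * √(M / Real.pi)))| := by
          congr 1; ring
      _ = 2 ^ (-(3 * M / 2)) * |tiltedIntegral (Fin (n + 1)) b c √(j : ℝ) -
          √(4 * Real.pi) ^ (n + 1) * (1 / 2 + c / √(j : ℝ) * √(M / Real.pi))| := by
          rw [abs_mul, abs_of_pos (by positivity)]
      _ ≤ 2 ^ (-(3 * M / 2)) * (C / j) := by gcongr
      _ = _ := by ring
  · filter_upwards [eventually_gt_atTop 0] with j hj
    have hj0 : (0 : ℝ) < j := by exact_mod_cast hj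
    have h := foldIntegral_eq_tiltedIntegral n (Real.sqrt_pos.2 hj0) l₁ l₂
    rw [Real.sq_sqrt hj0.le] at h
    rw [h, add_sub_cancel]
    have e1 : (√(j : ℝ) ^ (n + 1))⁻¹ = (j : ℝ) ^ (-M / 2) := by
      rw [← Real.rpow_natCast, ← hMdef, Real.sqrt_eq_rpow, ← Real.rpow_mul hj0.le,
        ← Real.rpow_neg hj0.le]
      ring_nf
    have e2 : ((2 : ℝ) ^ (-(2 * (j : ℝ) + b))) ^ (n + 1) =
        (4 : ℝ) ^ (-M * j) * 2 ^ (-M * (l₁ + l₂ - 2)) * 2 ^ (-(3 * M / 2)) := by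
      rw [← Real.rpow_natCast, ← hMdef, ← Real.rpow_mul two_pos.le,
        show (4 : ℝ) = 2 ^ (2 : ℝ) by norm_num, ← Real.rpow_mul two_pos.le,
        ← Real.rpow_add two_pos, ← Real.rpow_add two_pos, hb]
      ring_nf
    rw [e1, e2]
    ring
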